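/- Let $A$ be an $f$-algebra, i.e. a real vector lattice and associative real algebra (not necessarily unital) such that products of positive elements are positive and $a\wedge b=0$, $c\ge 0$ imply $(ca)\wedge b=(ac)\wedge b=0$. Let $A^{\sim}$ be its order dual, i.e. the vector lattice of all order bounded linear functionals on $A$, ordered by $f\le g$ iff $f(a)\le g(a)$ for all $a\ge 0$. Assume that $A^{\sim}$ separates the points of $A$. Let $(A^{\sim})^{\sim}_n$ be the set of all order continuous order bounded linear functionals on $A^{\sim}$. For $f\in A^{\sim}$, $a\in A$ and $F\in (A^{\sim})^{\sim}_n$ define $f\cdot a\in A^{\sim}$ by $(f\cdot a)(b)=f(ab)$ for $b\in A$, and $F\cdot f\in A^{\sim}$ by $(F\cdot f)(a)=F(f\cdot a)$ for $a\in A$, and put $$R(f)=\{F\cdot f : F\in (A^{\sim})^{\sim}_n\}.$$ Then, for every $f\in A^{\sim}$, $R(f)=R(|f|)$, and $R(f)$ is an order ideal in $A^{\sim}$, i.e. a linear subspace such that $|g|\le|h|$ and $h\in R(f)$ imply $g\in R(f)$. -/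

import Mathlib

open Set Filter Topology

/-!
Riesz spaces (vector lattices) are real modules with a lattice order satisfying
`IsOrderedAddMonoid` and `IsOrderedModule ℝ`.
-/

section RieszSpace

variable (L : Type*) [AddCommGroup L] [Module ℝ L] [Lattice L]

/-- The linear functionals on `L` which are bounded on every order interval. -/
def orderBoundedFunctionals : Submodule ℝ (L →ₗ[ℝ] ℝ) where
  carrier := {f | ∀ x y : L, ∃ C : ℝ, ∀ z ∈ Icc x y, |f z| ≤ C}
  zero_mem' := fun x y => ⟨0, fun z _ => by simp⟩
  add_mem' := by
    intro f g hf hg x y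
    obtain ⟨C, hC⟩ := hf x y
    obtain ⟨D, hD⟩ := hg x y
    exact ⟨C + D, fun z hz => (abs_add_le _ _).trans (add_le_add (hC z hz) (hD z hz))⟩
  smul_mem' := by
    intro c f hf x y
    obtain ⟨C, hC⟩ := hf x y
    refine ⟨|c| * C, fun z hz => ?_⟩
    rw [LinearMap.smul_apply, smul_eq_mul, abs_mul]
    exact mul_le_mul_of_nonneg_left (hC z hz) (abs_nonneg c)

/-- The order dual `L~` of a Riesz space `L`: the space of order bounded linear functionals.
Its order, `f ≤ g` iff `f x ≤ g x` for all `x ≥ 0`, is introduced below. -/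
def OrdDual : Type _ := ↥(orderBoundedFunctionals L)

namespace OrdDual

variable {L}

instance : AddCommGroup (OrdDual L) := inferInstanceAs (AddCommGroup ↥(orderBoundedFunctionals L))

instance : Module ℝ (OrdDual L) := inferInstanceAs (Module ℝ ↥(orderBoundedFunctionals L))

/-- The linear functional underlying an element of the order dual. -/
def toLin (f : OrdDual L) : L →ₗ[ℝ] ℝ := f.1

/-- An order bounded linear functional as an element of the order dual. -/
def mk (f : L →ₗ[ℝ] ℝ) (hf : ∀ x y : L, ∃ C : ℝ, ∀ z ∈ Icc x y, |f z| ≤ C) : OrdDual L := ⟨f, hf⟩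

instance : FunLike (OrdDual L) L ℝ where
  coe f := f.toLin
  coe_injective := fun _ _ h => Subtype.ext (DFunLike.coe_injective h)

instance : LinearMapClass (OrdDual L) ℝ L ℝ where
  map_add f := f.toLin.map_add
  map_smulₛₗ f := f.toLin.map_smul

@[ext] theorem ext {f g : OrdDual L} (h : ∀ x, f x = g x) : f = g := DFunLike.ext _ _ h

@[simp] theorem mk_apply (f : L →ₗ[ℝ] ℝ) (hf) (x : L) : mk f hf x = f x := rfl
@[simp] theorem add_apply (f g : OrdDual L) (x : L) : (f + g) x = f x + g x := rfl
@[simp] theorem sub_apply (f g : OrdDual L) (x : L) : (f - g) x = f x - g x := rfl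
@[simp] theorem neg_apply (f : OrdDual L) (x : L) : (-f) x = -f x := rfl
@[simp] theorem zero_apply (x : L) : (0 : OrdDual L) x = 0 := rfl
@[simp] theorem smul_apply (c : ℝ) (f : OrdDual L) (x : L) : (c • f) x = c * f x := rfl

theorem bounded (f : OrdDual L) (x y : L) : ∃ C : ℝ, ∀ z ∈ Icc x y, |f z| ≤ C := f.2 x y

variable [IsOrderedAddMonoid L] [IsOrderedModule ℝ L]

theorem eq_of_nonneg {f g : OrdDual L} (h : ∀ x, 0 ≤ x → f x = g x) : f = g := by
  ext x
  rw [← posPart_sub_negPart x, map_sub, map_sub, h _ (posPart_nonneg x), h _ (negPart_nonneg x)]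

instance : PartialOrder (OrdDual L) where
  le f g := ∀ x : L, 0 ≤ x → f x ≤ g x
  le_refl _ _ _ := le_rfl
  le_trans _ _ _ hfg hgh x hx := (hfg x hx).trans (hgh x hx)
  le_antisymm _ _ hfg hgf := eq_of_nonneg fun x hx => le_antisymm (hfg x hx) (hgf x hx)

theorem le_def {f g : OrdDual L} : f ≤ g ↔ ∀ x : L, 0 ≤ x → f x ≤ g x := Iff.rfl

instance : IsOrderedAddMonoid (OrdDual L) where
  add_le_add_left f g h k x hx := by simpa using h x hx

instance : IsOrderedModule ℝ (OrdDual L) where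
  smul_le_smul_of_nonneg_left c hc f g h x hx := mul_le_mul_of_nonneg_left (h x hx) hc
  smul_le_smul_of_nonneg_right f hf c d h x hx := mul_le_mul_of_nonneg_right h (hf x hx)

/-- The supremum of `f` over the order interval `[0, x]`; for `x ≥ 0` this is the value at `x` of
the positive part of `f`. -/
noncomputable def posSup (f : OrdDual L) (x : L) : ℝ := sSup (f '' Icc 0 x)

theorem le_posSup (f : OrdDual L) {x y : L} (hy : 0 ≤ y) (hyx : y ≤ x) : f y ≤ posSup f x := by
  obtain ⟨C, hC⟩ := f.bounded 0 x
  refine le_csSup ⟨C, ?_⟩ ⟨y, ⟨hy, hyx⟩, rfl⟩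
  rintro _ ⟨z, hz, rfl⟩
  exact (le_abs_self _).trans (hC z hz)

theorem posSup_le (f : OrdDual L) {x : L} (hx : 0 ≤ x) {b : ℝ}
    (h : ∀ y, 0 ≤ y → y ≤ x → f y ≤ b) : posSup f x ≤ b := by
  refine csSup_le ⟨f 0, 0, ⟨le_rfl, hx⟩, rfl⟩ ?_
  rintro _ ⟨z, hz, rfl⟩
  exact h z hz.1 hz.2

theorem posSup_add (f : OrdDual L) {x y : L} (hx : 0 ≤ x) (hy : 0 ≤ y) :
    posSup f (x + y) = posSup f x + posSup f y := by
  apply le_antisymm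
  · refine posSup_le f (add_nonneg hx hy) fun z hz hzxy => ?_
    have h1 : f (z ⊓ x) ≤ posSup f x := le_posSup f (le_inf hz hx) inf_le_right
    have h2 : f (z - z ⊓ x) ≤ posSup f y := by
      refine le_posSup f (sub_nonneg.2 inf_le_left) ?_
      rw [sub_le_iff_le_add, inf_comm, add_inf]
      exact le_inf (by rwa [add_comm]) (le_add_of_nonneg_left hy)
    rw [map_sub] at h2
    linarith
  · rw [← le_sub_iff_add_le]
    refine posSup_le f hx fun u hu hux => ?_
    rw [le_sub_comm]
    refine posSup_le f hy fun v hv hvy => ?_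
    have := le_posSup f (add_nonneg hu hv) (add_le_add hux hvy)
    rw [map_add] at this
    linarith

theorem posSup_smul (f : OrdDual L) {c : ℝ} (hc : 0 ≤ c) {x : L} (hx : 0 ≤ x) :
    posSup f (c • x) = c * posSup f x := by
  have key : ∀ (d : ℝ), 0 < d → ∀ y : L, 0 ≤ y → d * posSup f y ≤ posSup f (d • y) := by
    intro d hd y hy
    rw [← le_div_iff₀' hd]
    refine posSup_le f hy fun z hz hzy => ?_
    rw [le_div_iff₀' hd]
    have := le_posSup f (smul_nonneg hd.le hz) (smul_le_smul_of_nonneg_left hzy hd.le)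
    rwa [map_smul, smul_eq_mul] at this
  rcases hc.eq_or_lt with rfl | hc
  · rw [zero_smul, zero_mul]
    apply le_antisymm
    · refine posSup_le f le_rfl fun y h1 h2 => ?_
      rw [le_antisymm h2 h1, map_zero]
    · simpa using le_posSup f (le_refl (0 : L)) le_rfl
  · apply le_antisymm _ (key c hc x hx)
    have := key c⁻¹ (inv_pos.2 hc) (c • x) (smul_nonneg hc.le hx)
    rwa [inv_smul_smul₀ hc.ne', inv_mul_le_iff₀ hc] at this

theorem posSup_sub_eq (f : OrdDual L) {x u v : L} (hu : 0 ≤ u) (hv : 0 ≤ v) (h : x = u - v) :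
    posSup f x⁺ - posSup f x⁻ = posSup f u - posSup f v := by
  have e : x⁺ + v = u + x⁻ := by
    have := posPart_sub_negPart x
    rw [sub_eq_iff_eq_add] at this
    rw [this, h]; abel
  have e' := congrArg (posSup f) e
  rw [posSup_add f (posPart_nonneg x) hv, posSup_add f hu (negPart_nonneg x)] at e'
  linarith

/-- The positive part of `f`: the linear functional with value `sup {f y | 0 ≤ y ≤ x}` at each
`x ≥ 0` (Riesz–Kantorovich formula). -/
noncomputable def posLin (f : OrdDual L) : L →ₗ[ℝ] ℝ where
  toFun x := posSup f x⁺ - posSup f x⁻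
  map_add' x y := by
    rw [posSup_sub_eq f (add_nonneg (posPart_nonneg x) (posPart_nonneg y))
      (add_nonneg (negPart_nonneg x) (negPart_nonneg y))
      (by rw [add_sub_add_comm, posPart_sub_negPart, posPart_sub_negPart]),
      posSup_add f (posPart_nonneg x) (posPart_nonneg y),
      posSup_add f (negPart_nonneg x) (negPart_nonneg y)]
    ring
  map_smul' c x := by
    rcases le_total 0 c with hc | hc
    · rw [posSup_sub_eq f (smul_nonneg hc (posPart_nonneg x)) (smul_nonneg hc (negPart_nonneg x))
        (by rw [← smul_sub, posPart_sub_negPart]), posSup_smul f hc (posPart_nonneg x),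
        posSup_smul f hc (negPart_nonneg x)]
      simp only [RingHom.id_apply, smul_eq_mul]
      ring
    · have hc' : 0 ≤ -c := neg_nonneg.2 hc
      rw [posSup_sub_eq f (smul_nonneg hc' (negPart_nonneg x)) (smul_nonneg hc' (posPart_nonneg x))
        (by rw [← smul_sub, neg_smul, ← smul_neg, neg_sub, posPart_sub_negPart]),
        posSup_smul f hc' (posPart_nonneg x), posSup_smul f hc' (negPart_nonneg x)]
      simp only [RingHom.id_apply, smul_eq_mul]
      ring

theorem posLin_apply (f : OrdDual L) {x : L} (hx : 0 ≤ x) : posLin f x = posSup f x := by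
  have h0 : posSup f (0 : L) = 0 := by simpa using posSup_smul f le_rfl (le_refl (0 : L))
  have := posSup_sub_eq f hx le_rfl (sub_zero x).symm
  rw [h0, sub_zero] at this
  exact this

/-- A positive linear functional is order bounded. -/
theorem bounded_of_nonneg (g : L →ₗ[ℝ] ℝ) (hg : ∀ x, 0 ≤ x → 0 ≤ g x) (x y : L) :
    ∃ C : ℝ, ∀ z ∈ Icc x y, |g z| ≤ C := by
  refine ⟨|g x| + |g y|, fun z hz => ?_⟩
  have h1 := hg _ (sub_nonneg.2 hz.1)
  have h2 := hg _ (sub_nonneg.2 hz.2)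
  rw [map_sub] at h1 h2
  rw [abs_le]
  constructor
  · linarith [neg_abs_le (g x), abs_nonneg (g y)]
  · linarith [le_abs_self (g y), abs_nonneg (g x)]

theorem posLin_nonneg (f : OrdDual L) (x : L) (hx : 0 ≤ x) : 0 ≤ posLin f x := by
  rw [posLin_apply f hx]
  simpa using le_posSup f le_rfl hx

/-- The positive part of `f` as an element of the order dual. -/
noncomputable def pos (f : OrdDual L) : OrdDual L :=
  mk (posLin f) (bounded_of_nonneg _ (posLin_nonneg f))

theorem pos_apply (f : OrdDual L) {x : L} (hx : 0 ≤ x) : pos f x = sSup (f '' Icc 0 x) :=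
  posLin_apply f hx

theorem isLUB_pos (f : OrdDual L) : IsLUB {f, 0} (pos f) := by
  constructor
  · rintro g (rfl | rfl) x hx
    · rw [pos_apply _ hx]; exact le_posSup _ hx le_rfl
    · exact posLin_nonneg f x hx
  · intro g hg x hx
    have h1 : f ≤ g := hg (Or.inl rfl)
    have h2 : 0 ≤ g := hg (Or.inr rfl)
    rw [pos_apply _ hx]
    refine posSup_le f hx fun y hy hyx => (h1 y hy).trans ?_
    have := h2 _ (sub_nonneg.2 hyx)
    simp only [map_sub, zero_apply] at this
    linarith

/-- The order dual is a Riesz space. The supremum and infimum are those of the order above. -/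
noncomputable instance : Lattice (OrdDual L) where
  sup f g := g + pos (f - g)
  le_sup_left f g := by
    have := (isLUB_pos (f - g)).1 (Or.inl rfl)
    exact sub_le_iff_le_add'.1 this
  le_sup_right f g := by
    have := (isLUB_pos (f - g)).1 (Or.inr rfl)
    exact le_add_of_nonneg_right this
  sup_le f g h hf hg := by
    have : pos (f - g) ≤ h - g := by
      refine (isLUB_pos (f - g)).2 ?_
      rintro k (rfl | rfl)
      · exact sub_le_sub_right hf g
      · exact sub_nonneg.2 hg
    exact le_sub_iff_add_le'.1 this
  inf f g := f - pos (f - g)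
  inf_le_left f g := by
    have := (isLUB_pos (f - g)).1 (Or.inr rfl)
    exact sub_le_self f this
  inf_le_right f g := by
    have := (isLUB_pos (f - g)).1 (Or.inl rfl)
    exact sub_le_comm.1 this
  le_inf h f g hf hg := by
    have : pos (f - g) ≤ f - h := by
      refine (isLUB_pos (f - g)).2 ?_
      rintro k (rfl | rfl)
      · exact sub_le_sub_left hg f
      · exact sub_nonneg.2 hf
    exact le_sub_comm.1 this

/-- `f` is order continuous: `f x_α → 0` for every net `x_α ↓ 0`. A decreasing net is represented
by its range, a nonempty downward directed set `D` with infimum `0`. -/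
def IsOrderContinuous (f : OrdDual L) : Prop :=
  ∀ D : Set L, D.Nonempty → DirectedOn (· ≥ ·) D → IsGLB D 0 →
    Tendsto (fun d : D => f d) atBot (𝓝 0)

end OrdDual

/-- The order dual separates the points of `L`: if `f x = 0` for all `f` in the order dual,
then `x = 0`. -/
def HasSeparatingOrdDual : Prop := ∀ x : L, (∀ f : OrdDual L, f x = 0) → x = 0

variable {L}

/-- An order ideal of `L`: a linear subspace `S` such that `|y| ≤ |x|` and `x ∈ S` imply
`y ∈ S`. -/
def IsOrderIdeal (S : Set L) : Prop :=
  (∃ I : Submodule ℝ L, (I : Set L) = S) ∧ LatticeOrderedAddCommGroup.IsSolid S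

end RieszSpace

/-- An `f`-algebra (not necessarily unital): a Riesz space which is an associative real algebra
whose multiplication satisfies the conditions below. -/
class IsFAlgebra (A : Type*) [NonUnitalRing A] [Module ℝ A] [Lattice A] : Prop extends
    IsOrderedAddMonoid A, IsOrderedModule ℝ A, IsScalarTower ℝ A A, SMulCommClass ℝ A A where
  mul_nonneg : ∀ a b : A, 0 ≤ a → 0 ≤ b → 0 ≤ a * b
  mul_left_disjoint : ∀ a b c : A, a ⊓ b = 0 → 0 ≤ c → (c * a) ⊓ b = 0
  mul_right_disjoint : ∀ a b c : A, a ⊓ b = 0 → 0 ≤ c → (a * c) ⊓ b = 0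

section FAlgebra

variable {A : Type*} [NonUnitalRing A] [Module ℝ A] [Lattice A] [IsFAlgebra A]

namespace OrdDual

theorem mul_mem_Icc {a : A} (ha : 0 ≤ a) {x y z : A} (hz : z ∈ Icc x y) :
    a * z ∈ Icc (a * x) (a * y) := by
  constructor
  · rw [← sub_nonneg, ← mul_sub]
    exact IsFAlgebra.mul_nonneg _ _ ha (sub_nonneg.2 hz.1)
  · rw [← sub_nonneg, ← mul_sub]
    exact IsFAlgebra.mul_nonneg _ _ ha (sub_nonneg.2 hz.2)

/-- The functional `f · a`, given by `(f · a)(b) = f (a b)`. -/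
def dotElem (f : OrdDual A) (a : A) : OrdDual A :=
  mk (f.toLin ∘ₗ LinearMap.mulLeft ℝ a) (by
    intro x y
    obtain ⟨C, hC⟩ := f.bounded (a⁺ * x) (a⁺ * y)
    obtain ⟨D, hD⟩ := f.bounded (a⁻ * x) (a⁻ * y)
    refine ⟨C + D, fun z hz => ?_⟩
    have e : (f.toLin ∘ₗ LinearMap.mulLeft ℝ a) z = f (a⁺ * z) - f (a⁻ * z) := by
      rw [← map_sub, ← sub_mul, posPart_sub_negPart]
      rfl
    rw [e]
    exact (abs_sub _ _).trans (add_le_add (hC _ (mul_mem_Icc (posPart_nonneg a) hz))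
      (hD _ (mul_mem_Icc (negPart_nonneg a) hz))))

@[simp] theorem dotElem_apply (f : OrdDual A) (a b : A) : dotElem f a b = f (a * b) := rfl

/-- The linear functional `a ↦ F (f · a)` on `A`. -/
noncomputable def dotLin (F : OrdDual (OrdDual A)) (f : OrdDual A) : A →ₗ[ℝ] ℝ where
  toFun a := F (dotElem f a)
  map_add' a b := by
    rw [← map_add]
    congr 1
    ext x
    simp [add_mul]
  map_smul' c a := by
    rw [RingHom.id_apply, ← map_smul]
    congr 1
    ext x
    simp [smul_mul_assoc]

theorem dotLin_bounded (F : OrdDual (OrdDual A)) (f : OrdDual A) (x y : A) :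
    ∃ C : ℝ, ∀ z ∈ Icc x y, |dotLin F f z| ≤ C := by
  have mono : ∀ g : OrdDual A, 0 ≤ g → ∀ z ∈ Icc x y,
      dotElem g z ∈ Icc (dotElem g x) (dotElem g y) := by
    intro g hg z hz
    constructor
    · intro b hb
      have := hg _ (IsFAlgebra.mul_nonneg _ _ (sub_nonneg.2 hz.1) hb)
      rw [sub_mul, map_sub, zero_apply] at this
      simpa using this
    · intro b hb
      have := hg _ (IsFAlgebra.mul_nonneg _ _ (sub_nonneg.2 hz.2) hb)
      rw [sub_mul, map_sub, zero_apply] at this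
      simpa using this
  obtain ⟨C, hC⟩ := F.bounded (dotElem f⁺ x) (dotElem f⁺ y)
  obtain ⟨D, hD⟩ := F.bounded (dotElem f⁻ x) (dotElem f⁻ y)
  refine ⟨C + D, fun z hz => ?_⟩
  have e : dotLin F f z = F (dotElem f⁺ z) - F (dotElem f⁻ z) := by
    rw [← map_sub]
    change F _ = F _
    congr 1
    ext b
    rw [sub_apply, dotElem_apply, dotElem_apply, dotElem_apply, ← sub_apply, posPart_sub_negPart]
  rw [e]
  exact (abs_sub _ _).trans (add_le_add (hC _ (mono _ (posPart_nonneg f) z hz))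
    (hD _ (mono _ (negPart_nonneg f) z hz)))

/-- The functional `F · f` in the order dual of `A`, given by `(F · f)(a) = F (f · a)`. -/
noncomputable def dot (F : OrdDual (OrdDual A)) (f : OrdDual A) : OrdDual A := mk (dotLin F f) (dotLin_bounded F f)

@[simp] theorem dot_apply (F : OrdDual (OrdDual A)) (f : OrdDual A) (a : A) :
    dot F f a = F (dotElem f a) := rfl

/-- `R(f) = {F · f | F}`, where `F` runs through the order continuous part of the order bidual
of `A`. -/
def R (f : OrdDual A) : Set (OrdDual A) :=
  {g | ∃ F : OrdDual (OrdDual A), F.IsOrderContinuous ∧ dot F f = g}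

end OrdDual

end FAlgebra

/-!
In each of its two variables the product `f · a` carries disjoint positive elements to disjoint
functionals, so `|f · a| = |f| · |a|`. For `H ≥ 0` this turns `H |f · a|` into `(H · |f|) |a|`.
By the Hahn–Banach theorem, a functional `g` with `|g| ≤ H · |f|` therefore factors through
`a ↦ f · a`, with a factor dominated by `H`. Thus `R(f)` consists of all `g` with `|g| ≤ H · |f|`
for some positive order continuous `H`, a description that depends on `|f|` only and is solid.
-/

section LatticeOrderedGroup

variable {G : Type*} [AddCommGroup G] [Lattice G]

theorem abs_smul_le {R : Type*} [Ring R] [LinearOrder R] [IsOrderedRing R] [Module R G]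
    [PosSMulMono R G] (c : R) (x : G) : |c • x| ≤ |c| • |x| := by
  have of_nonneg : ∀ d : R, 0 ≤ d → |d • x| ≤ d • |x| := fun d hd => by
    refine abs_le'.2 ⟨smul_le_smul_of_nonneg_left (le_abs_self x) hd, ?_⟩
    rw [← smul_neg]
    exact smul_le_smul_of_nonneg_left (neg_le_abs x) hd
  rcases le_total 0 c with hc | hc
  · simpa only [abs_of_nonneg hc] using of_nonneg c hc
  · simpa only [abs_of_nonpos hc, neg_smul, abs_neg] using of_nonneg (-c) (neg_nonneg.2 hc)

variable [IsOrderedAddMonoid G]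

theorem abs_sub_eq_add_of_abs_inf_abs_eq_zero {x y : G} (h : |x| ⊓ |y| = 0) :
    |x - y| = |x| + |y| := by
  refine le_antisymm (by simpa [sub_eq_add_neg] using abs_add_le x (-y)) ?_
  calc |x| + |y| = |x| ⊔ |y| - |x| ⊓ |y| := by rw [← inf_add_sup, h, zero_add, sub_zero]
    _ = |(|y| - |x|)| := sup_sub_inf_eq_abs_sub _ _
    _ ≤ |x - y| := by rw [abs_sub_comm x]; exact abs_abs_sub_abs_le y x

theorem le_of_le_add_of_inf_eq_zero {x y z : G} (hy : 0 ≤ y) (h : x ≤ y + z) (hxz : x ⊓ z = 0) :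
    x ≤ y := by
  calc x ≤ (y + x) ⊓ (y + z) := le_inf (le_add_of_nonneg_left hy) h
    _ = y := by rw [← add_inf, hxz, add_zero]

end LatticeOrderedGroup

theorem exists_dual_comp_eq_of_norm_le_seminorm {𝕜 E F : Type*} [NormedField 𝕜]
    [IsRCLikeNormedField 𝕜] [AddCommGroup E] [Module 𝕜 E] [AddCommGroup F] [Module 𝕜 F]
    (T : E →ₗ[𝕜] F) (φ : Module.Dual 𝕜 E) {p : Seminorm 𝕜 F} (h : ∀ x, ‖φ x‖ ≤ p (T x)) :
    ∃ ψ : Module.Dual 𝕜 F, ψ ∘ₗ T = φ ∧ ∀ y, ‖ψ y‖ ≤ p y := by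
  have hφ : φ ∈ (LinearMap.ker T).dualAnnihilator := by
    refine (Submodule.mem_dualAnnihilator φ).2 fun x hx => norm_le_zero_iff.1 ?_
    simpa only [LinearMap.mem_ker.1 hx, map_zero] using h x
  rw [← LinearMap.range_dualMap_eq_dualAnnihilator_ker] at hφ
  obtain ⟨θ, rfl⟩ := hφ
  obtain ⟨ψ, hψ, hψp⟩ := Module.Dual.exists_extension_of_le_seminorm (LinearMap.range T)
    (θ.domRestrict _) (p := p) (by rintro ⟨_, x, rfl⟩; exact h x)
  exact ⟨ψ, LinearMap.ext fun x => hψ ⟨T x, x, rfl⟩, hψp⟩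

namespace OrdDual

section RieszSpace

variable {L : Type*} [AddCommGroup L] [Module ℝ L] [Lattice L]

variable (L) in
/-- The band `L~ₙ` of order continuous functionals, as a linear subspace of the order dual. -/
def orderContinuousDual : Submodule ℝ (OrdDual L) where
  carrier := {F | F.IsOrderContinuous}
  zero_mem' _ _ _ _ := tendsto_const_nhds
  add_mem' hF hG D hne hdir hglb := by
    simpa using (hF D hne hdir hglb).add (hG D hne hdir hglb)
  smul_mem' c F hF D hne hdir hglb := by
    simpa using (hF D hne hdir hglb).const_mul c

theorem IsOrderContinuous.of_abs_le {F G : OrdDual L} (hF : F.IsOrderContinuous)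
    (h : ∀ x : L, 0 ≤ x → |G x| ≤ F x) : G.IsOrderContinuous := fun D hne hdir hglb =>
  squeeze_zero_norm (fun d => h d (hglb.1 d.2)) (hF D hne hdir hglb)

theorem IsOrderContinuous.tendsto_inf {F : OrdDual L} (hF : F.IsOrderContinuous) {D : Set L}
    (hne : D.Nonempty) (hdir : DirectedOn (· ≥ ·) D) (hglb : IsGLB D 0) {y : L} (hy : 0 ≤ y) :
    Tendsto (fun d : D => F (y ⊓ d)) atBot (𝓝 0) := by
  have hdir' : DirectedOn (· ≥ ·) ((y ⊓ ·) '' D) := by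
    rintro _ ⟨d, hd, rfl⟩ _ ⟨e, he, rfl⟩
    obtain ⟨k, hk, hkd, hke⟩ := hdir d hd e he
    exact ⟨y ⊓ k, ⟨k, hk, rfl⟩, inf_le_inf_left y hkd, inf_le_inf_left y hke⟩
  have hglb' : IsGLB ((y ⊓ ·) '' D) 0 := by
    refine ⟨?_, fun b hb => hglb.2 fun d hd => (hb ⟨d, hd, rfl⟩).trans inf_le_right⟩
    rintro _ ⟨d, hd, rfl⟩
    exact le_inf hy (hglb.1 hd)
  have hinf : Tendsto (fun d : D => (⟨y ⊓ d, d, d.2, rfl⟩ : (y ⊓ ·) '' D)) atBot atBot := by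
    refine tendsto_atBot_atBot_of_monotone (fun d e hde => inf_le_inf_left y hde) ?_
    rintro ⟨_, d, hd, rfl⟩
    exact ⟨⟨d, hd⟩, le_rfl⟩
  exact (hF _ (hne.image _) hdir' hglb').comp hinf

theorem exists_lt_apply_of_lt_posSup (f : OrdDual L) {x : L} (hx : 0 ≤ x) {r : ℝ}
    (hr : r < posSup f x) : ∃ y, 0 ≤ y ∧ y ≤ x ∧ r < f y := by
  obtain ⟨_, ⟨y, hy, rfl⟩, hry⟩ := exists_lt_of_lt_csSup ((nonempty_Icc.2 hx).image f) hr
  exact ⟨y, hy.1, hy.2, hry⟩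

variable [IsOrderedAddMonoid L] [IsOrderedModule ℝ L]

theorem apply_mono {F : OrdDual L} (hF : 0 ≤ F) {x y : L} (hxy : x ≤ y) : F x ≤ F y := by
  have h : 0 ≤ F (y - x) := hF _ (sub_nonneg.2 hxy)
  rwa [map_sub, sub_nonneg] at h

theorem abs_le_iff {f g : OrdDual L} : |f| ≤ g ↔ ∀ x : L, 0 ≤ x → |f x| ≤ g x := by
  simp only [abs_le', le_def, neg_apply, ← forall_and]

theorem abs_apply_le (f : OrdDual L) (x : L) : |f x| ≤ |f| |x| := by
  have h : ∀ y : L, 0 ≤ y → |f y| ≤ |f| y := abs_le_iff.1 le_rfl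
  calc |f x| = |f x⁺ - f x⁻| := by rw [← map_sub, posPart_sub_negPart]
    _ ≤ |f x⁺| + |f x⁻| := abs_sub _ _
    _ ≤ |f| x⁺ + |f| x⁻ := add_le_add (h _ (posPart_nonneg x)) (h _ (negPart_nonneg x))
    _ = |f| |x| := by rw [← map_add, posPart_add_negPart]

theorem posPart_apply (f : OrdDual L) {x : L} (hx : 0 ≤ x) : f⁺ x = posSup f x := by
  have h : f⁺ = pos f := isLUB_pair.unique (isLUB_pos f)
  rw [h]
  exact posLin_apply f hx

theorem posPart_apply_le (f : OrdDual L) {x y z : L} (hyx : y ≤ x) (hzx : z ≤ x) :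
    f⁺ z ≤ f⁺ x - f y + f (y ⊓ z) := by
  have h : f (y - z)⁺ ≤ f⁺ (x - z) := by
    refine (le_posPart f _ (posPart_nonneg _)).trans (apply_mono (posPart_nonneg f) ?_)
    exact sup_le (sub_le_sub_right hyx z) (sub_nonneg.2 hzx)
  rw [map_sub] at h
  rw [inf_eq_sub_posPart_sub, map_sub]
  linarith

theorem IsOrderContinuous.posPart {F : OrdDual L} (hF : F.IsOrderContinuous) :
    F⁺.IsOrderContinuous := by
  intro D hne hdir hglb
  have hF0 : 0 ≤ F⁺ := posPart_nonneg F
  obtain ⟨x, hxD⟩ := id hne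
  have hx : 0 ≤ x := hglb.1 hxD
  refine tendsto_order.2 ⟨fun r hr => ?_, fun ε hε => ?_⟩
  · exact Eventually.of_forall fun d => hr.trans_le (hF0 d (hglb.1 d.2))
  obtain ⟨y, hy, hyx, hFy⟩ := exists_lt_apply_of_lt_posSup F hx
    (show F⁺ x - ε / 2 < posSup F x by rw [← posPart_apply F hx]; linarith)
  filter_upwards [(hF.tendsto_inf hne hdir hglb hy).eventually_lt_const (half_pos hε),
    Iic_mem_atBot (⟨x, hxD⟩ : D)] with d hFd hdx
  linarith [posPart_apply_le F hyx hdx]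

theorem IsOrderContinuous.abs {F : OrdDual L} (hF : F.IsOrderContinuous) :
    |F|.IsOrderContinuous := by
  have hneg : F⁻.IsOrderContinuous := by
    rw [← posPart_neg]
    exact ((orderContinuousDual L).neg_mem hF).posPart
  rw [← posPart_add_negPart F]
  exact (orderContinuousDual L).add_mem hF.posPart hneg

theorem inf_eq_zero_iff {f g : OrdDual L} (hf : 0 ≤ f) (hg : 0 ≤ g) :
    f ⊓ g = 0 ↔ ∀ b : L, 0 ≤ b → ∀ ε : ℝ, 0 < ε → ∃ c, 0 ≤ c ∧ c ≤ b ∧ f c + g (b - c) < ε := by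
  have inf_apply : ∀ b, 0 ≤ b → (f ⊓ g) b = f b - posSup (f - g) b := fun b hb => by
    rw [inf_eq_sub_posPart_sub, sub_apply, posPart_apply _ hb]
  constructor
  · intro h b hb ε hε
    have hb0 := inf_apply b hb
    rw [h, zero_apply] at hb0
    obtain ⟨y, hy, hyb, hlt⟩ := exists_lt_apply_of_lt_posSup (f - g) hb
      (show f b - ε < posSup (f - g) b by linarith)
    refine ⟨b - y, sub_nonneg.2 hyb, sub_le_self b hy, ?_⟩
    rw [sub_apply] at hlt
    rw [sub_sub_cancel, map_sub]
    linarith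
  · intro h
    refine le_antisymm (fun b hb => le_of_forall_pos_le_add fun ε hε => ?_) (le_inf hf hg)
    obtain ⟨c, hc, hcb, hlt⟩ := h b hb ε hε
    have hle := le_posSup (f - g) (sub_nonneg.2 hcb) (sub_le_self b hc)
    rw [sub_apply, map_sub f] at hle
    rw [inf_apply b hb, zero_apply]
    linarith

/-- The seminorm `x ↦ H |x|` of a positive functional `H`, by which Hahn–Banach extensions are
controlled. -/
noncomputable def absSeminorm (H : OrdDual L) (hH : 0 ≤ H) : Seminorm ℝ L :=
  Seminorm.ofSMulLE (fun x => H |x|) (by rw [abs_zero, map_zero])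
    (fun x y => by rw [← map_add]; exact apply_mono hH (abs_add_le x y))
    (fun c x => by
      rw [Real.norm_eq_abs, ← smul_eq_mul, ← map_smul]
      exact apply_mono hH (abs_smul_le c x))

theorem mem_orderBoundedFunctionals_of_le {φ : L →ₗ[ℝ] ℝ} {H : OrdDual L}
    (h : ∀ x, 0 ≤ x → φ x ≤ H x) : φ ∈ orderBoundedFunctionals L := by
  have hsub : H.toLin - φ ∈ orderBoundedFunctionals L :=
    bounded_of_nonneg _ fun x hx => sub_nonneg.2 (h x hx)
  simpa only [sub_sub_cancel] using sub_mem (show H.toLin ∈ _ from H.2) hsub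

theorem exists_factor_of_abs_le {E : Type*} [AddCommGroup E] [Module ℝ E] (T : E →ₗ[ℝ] L)
    (φ : E →ₗ[ℝ] ℝ) {H : OrdDual L} (hH : 0 ≤ H) (h : ∀ x, |φ x| ≤ H |T x|) :
    ∃ G : OrdDual L, (∀ x, G (T x) = φ x) ∧ |G| ≤ H := by
  obtain ⟨ψ, hψ, hψH⟩ := exists_dual_comp_eq_of_norm_le_seminorm T φ (p := absSeminorm H hH) h
  have hle : ∀ x, 0 ≤ x → |ψ x| ≤ H x := fun x hx => by
    have hx' : |ψ x| ≤ H |x| := hψH x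
    rwa [abs_of_nonneg hx] at hx'
  exact ⟨mk ψ (mem_orderBoundedFunctionals_of_le fun x hx => (le_abs_self _).trans (hle x hx)),
    LinearMap.congr_fun hψ, abs_le_iff.2 hle⟩

end RieszSpace

end OrdDual

section FAlgebra

variable {A : Type*} [NonUnitalRing A] [Module ℝ A] [Lattice A] [IsFAlgebra A]

namespace IsFAlgebra

theorem mul_le_mul_of_nonneg_left {a b c : A} (h : a ≤ b) (hc : 0 ≤ c) : c * a ≤ c * b :=
  (OrdDual.mul_mem_Icc hc (x := a) ⟨h, le_rfl⟩).1

theorem mul_eq_zero_of_inf_eq_zero {a b : A} (h : a ⊓ b = 0) : a * b = 0 := by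
  have ha : 0 ≤ a := h ▸ inf_le_left
  have hb : 0 ≤ b := h ▸ inf_le_right
  have hab : b ⊓ a * b = 0 := by rw [inf_comm, mul_right_disjoint a b b h hb]
  simpa only [inf_idem] using mul_left_disjoint b (a * b) a hab ha

theorem mul_posPart_self_nonneg (x : A) : 0 ≤ x * x⁺ := by
  have hx : x⁻ * x⁺ = 0 :=
    mul_eq_zero_of_inf_eq_zero (by rw [inf_comm, posPart_inf_negPart_eq_zero])
  calc 0 ≤ x⁺ * x⁺ := IsFAlgebra.mul_nonneg _ _ (posPart_nonneg x) (posPart_nonneg x)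
    _ = (x⁺ - x⁻) * x⁺ := by rw [sub_mul, hx, sub_zero]
    _ = x * x⁺ := by rw [posPart_sub_negPart]

theorem mul_posPart_sub_le {b u : A} (hb : 0 ≤ b) (hu : 0 ≤ u) : u * (b - u)⁺ ≤ b * b := by
  have h : u * (b - u)⁺ ≤ b * (b - u)⁺ := by
    simpa only [sub_mul, sub_nonneg] using mul_posPart_self_nonneg (b - u)
  exact h.trans (mul_le_mul_of_nonneg_left (sup_le (sub_le_self b hu) hb) hb)

/-- This is `π ≤ 1 + π²` for the operator `π` of multiplication by `a`, in the absence of a unit.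
It holds because `π` maps the negative part of `π c - c`, which is at most `c`, to an element
disjoint from the positive part. -/
theorem mul_le_add_mul_mul {a c : A} (ha : 0 ≤ a) (hc : 0 ≤ c) : a * c ≤ c + a * (a * c) := by
  set x := a * c - c with hx
  have hxc : x⁻ ≤ c := by
    refine sup_le ?_ hc
    rw [hx, neg_sub]
    exact sub_le_self c (IsFAlgebra.mul_nonneg a c ha hc)
  have hdisj : a * x⁻ ⊓ x⁺ = 0 :=
    mul_left_disjoint _ _ _ (by rw [inf_comm, posPart_inf_negPart_eq_zero]) ha
  have hneg : a * x⁻ ≤ c := by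
    refine le_of_le_add_of_inf_eq_zero hc ?_ hdisj
    calc a * x⁻ ≤ a * c := mul_le_mul_of_nonneg_left hxc ha
      _ = c + x := by rw [hx, add_sub_cancel]
      _ ≤ c + x⁺ := add_le_add_right (le_posPart x) c
  have hax : -c ≤ a * x :=
    calc -c ≤ -(a * x⁻) := neg_le_neg hneg
      _ = a * (-x⁻) := (mul_neg _ _).symm
      _ ≤ a * x := mul_le_mul_of_nonneg_left (neg_le.1 (neg_le_negPart x)) ha
  rw [hx, mul_sub, neg_le_sub_iff_le_add] at hax
  exact hax.trans_eq (add_comm _ _)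

end IsFAlgebra

namespace OrdDual

theorem dotElem_nonneg {f : OrdDual A} (hf : 0 ≤ f) {a : A} (ha : 0 ≤ a) : 0 ≤ dotElem f a :=
  fun _ hb => hf _ (IsFAlgebra.mul_nonneg _ _ ha hb)

/-- The linear map `a ↦ f · a`. -/
def dotElemₗ (f : OrdDual A) : A →ₗ[ℝ] OrdDual A where
  toFun := dotElem f
  map_add' a b := by ext x; simp [add_mul]
  map_smul' c a := by ext x; simp [smul_mul_assoc]

/-- The linear map `F ↦ F · f`. -/
noncomputable def dotₗ (f : OrdDual A) : OrdDual (OrdDual A) →ₗ[ℝ] OrdDual A where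
  toFun F := dot F f
  map_add' _ _ := rfl
  map_smul' _ _ := rfl

theorem dotElem_inf_dotElem_of_inf_eq_zero {f : OrdDual A} (hf : 0 ≤ f) {a u : A} (h : a ⊓ u = 0) :
    dotElem f a ⊓ dotElem f u = 0 := by
  have ha : 0 ≤ a := h ▸ inf_le_left
  have hu : 0 ≤ u := h ▸ inf_le_right
  refine (inf_eq_zero_iff (dotElem_nonneg hf ha) (dotElem_nonneg hf hu)).2 fun b hb ε hε => ?_
  obtain ⟨δ, hδ, hδε⟩ := exists_pos_mul_lt hε (f (b * b))
  have hv : 0 ≤ δ⁻¹ • u := smul_nonneg (inv_nonneg.2 hδ.le) hu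
  have ha0 : a * (b ⊓ δ⁻¹ • u) = 0 := by
    refine le_antisymm ?_ (IsFAlgebra.mul_nonneg _ _ ha (le_inf hb hv))
    calc a * (b ⊓ δ⁻¹ • u) ≤ a * (δ⁻¹ • u) :=
          IsFAlgebra.mul_le_mul_of_nonneg_left inf_le_right ha
      _ = 0 := by rw [mul_smul_comm, IsFAlgebra.mul_eq_zero_of_inf_eq_zero h, smul_zero]
  have hu_le : u * (b - b ⊓ δ⁻¹ • u) ≤ δ • (b * b) := by
    rw [inf_eq_sub_posPart_sub, sub_sub_cancel, ← inv_smul_le_iff_of_pos hδ, ← smul_mul_assoc]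
    exact IsFAlgebra.mul_posPart_sub_le hb hv
  refine ⟨b ⊓ δ⁻¹ • u, le_inf hb hv, inf_le_left, ?_⟩
  calc f (a * (b ⊓ δ⁻¹ • u)) + f (u * (b - b ⊓ δ⁻¹ • u))
      ≤ f (δ • (b * b)) := by rw [ha0, map_zero, zero_add]; exact apply_mono hf hu_le
    _ = f (b * b) * δ := by rw [map_smul, smul_eq_mul, mul_comm]
    _ < ε := hδε

theorem mul_apply_mul_le {f : OrdDual A} (hf : 0 ≤ f) {a b c : A} (ha : 0 ≤ a) (hc : 0 ≤ c)
    (hcb : c ≤ b) {δ : ℝ} (hδ : 0 ≤ δ) :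
    δ * f (a * c) ≤ f c + δ * (δ * f (a * (a * b))) := by
  have h := apply_mono hf (IsFAlgebra.mul_le_add_mul_mul (smul_nonneg hδ ha) hc)
  simp only [smul_mul_assoc, mul_smul_comm, map_add, map_smul, smul_eq_mul] at h
  have hmono : f (a * (a * c)) ≤ f (a * (a * b)) := apply_mono hf <|
    IsFAlgebra.mul_le_mul_of_nonneg_left (IsFAlgebra.mul_le_mul_of_nonneg_left hcb ha) ha
  exact h.trans (by gcongr)

theorem dotElem_inf_dotElem_of_nonneg {f g : OrdDual A} (h : f ⊓ g = 0) {a : A} (ha : 0 ≤ a) :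
    dotElem f a ⊓ dotElem g a = 0 := by
  have hf : 0 ≤ f := h ▸ inf_le_left
  have hg : 0 ≤ g := h ▸ inf_le_right
  refine (inf_eq_zero_iff (dotElem_nonneg hf ha) (dotElem_nonneg hg ha)).2 fun b hb ε hε => ?_
  obtain ⟨δ, hδ, hδε⟩ :=
    exists_pos_mul_lt (half_pos hε) (f (a * (a * b)) + g (a * (a * b)))
  obtain ⟨c, hc, hcb, hlt⟩ :=
    (inf_eq_zero_iff hf hg).1 h b hb (δ * (ε / 2)) (mul_pos hδ (half_pos hε))
  refine ⟨c, hc, hcb, lt_of_mul_lt_mul_left ?_ hδ.le⟩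
  calc δ * (f (a * c) + g (a * (b - c)))
      ≤ (f c + δ * (δ * f (a * (a * b)))) + (g (b - c) + δ * (δ * g (a * (a * b)))) := by
        rw [mul_add]
        exact add_le_add (mul_apply_mul_le hf ha hc hcb hδ.le)
          (mul_apply_mul_le hg ha (sub_nonneg.2 hcb) (sub_le_self b hc) hδ.le)
    _ = (f c + g (b - c)) + δ * ((f (a * (a * b)) + g (a * (a * b))) * δ) := by ring
    _ < δ * (ε / 2) + δ * (ε / 2) := add_lt_add hlt (mul_lt_mul_of_pos_left hδε hδ)
    _ = δ * ε := by ring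

theorem abs_dotElem_of_nonneg {f : OrdDual A} (hf : 0 ≤ f) (a : A) :
    |dotElem f a| = dotElem f |a| := by
  have hpos := abs_of_nonneg (dotElem_nonneg hf (posPart_nonneg a))
  have hneg := abs_of_nonneg (dotElem_nonneg hf (negPart_nonneg a))
  have hdisj : |dotElem f a⁺| ⊓ |dotElem f a⁻| = 0 := by
    rw [hpos, hneg]
    exact dotElem_inf_dotElem_of_inf_eq_zero hf (posPart_inf_negPart_eq_zero a)
  calc |dotElem f a| = |dotElem f (a⁺ - a⁻)| := by rw [posPart_sub_negPart]
    _ = |dotElem f a⁺ - dotElem f a⁻| := congrArg _ (map_sub (dotElemₗ f) _ _)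
    _ = dotElem f a⁺ + dotElem f a⁻ := by
      rw [abs_sub_eq_add_of_abs_inf_abs_eq_zero hdisj, hpos, hneg]
    _ = dotElem f (a⁺ + a⁻) := (map_add (dotElemₗ f) _ _).symm
    _ = dotElem f |a| := by rw [posPart_add_negPart]

theorem abs_dotElem (f : OrdDual A) (a : A) : |dotElem f a| = dotElem |f| |a| := by
  have hpos := abs_dotElem_of_nonneg (posPart_nonneg f) a
  have hneg := abs_dotElem_of_nonneg (negPart_nonneg f) a
  have hdisj : |dotElem f⁺ a| ⊓ |dotElem f⁻ a| = 0 := by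
    rw [hpos, hneg]
    exact dotElem_inf_dotElem_of_nonneg (posPart_inf_negPart_eq_zero f) (abs_nonneg a)
  calc |dotElem f a| = |dotElem (f⁺ - f⁻) a| := by rw [posPart_sub_negPart]
    _ = |dotElem f⁺ a - dotElem f⁻ a| := rfl
    _ = dotElem f⁺ |a| + dotElem f⁻ |a| := by
      rw [abs_sub_eq_add_of_abs_inf_abs_eq_zero hdisj, hpos, hneg]
    _ = dotElem (f⁺ + f⁻) |a| := rfl
    _ = dotElem |f| |a| := by rw [posPart_add_negPart]

theorem abs_dot_le (F : OrdDual (OrdDual A)) (f : OrdDual A) : |dot F f| ≤ dot |F| |f| :=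
  abs_le_iff.2 fun a ha =>
    calc |F (dotElem f a)| ≤ |F| |dotElem f a| := abs_apply_le F _
      _ = |F| (dotElem |f| a) := by rw [abs_dotElem, abs_of_nonneg ha]

theorem exists_dot_eq_of_abs_le {f g : OrdDual A} {H : OrdDual (OrdDual A)} (hH : 0 ≤ H)
    (h : |g| ≤ dot H |f|) : ∃ G : OrdDual (OrdDual A), |G| ≤ H ∧ dot G f = g := by
  obtain ⟨G, hG, hGH⟩ := exists_factor_of_abs_le (dotElemₗ f) g.toLin hH fun a =>
    calc |g a| ≤ |g| |a| := abs_apply_le g a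
      _ ≤ H (dotElem |f| |a|) := h _ (abs_nonneg a)
      _ = H |dotElem f a| := by rw [abs_dotElem]
  exact ⟨G, hGH, ext hG⟩

theorem mem_R_iff {f g : OrdDual A} :
    g ∈ R f ↔ ∃ H : OrdDual (OrdDual A), 0 ≤ H ∧ H.IsOrderContinuous ∧ |g| ≤ dot H |f| := by
  constructor
  · rintro ⟨F, hF, rfl⟩
    exact ⟨|F|, abs_nonneg F, hF.abs, abs_dot_le F f⟩
  · rintro ⟨H, hH, hHc, hg⟩
    obtain ⟨G, hGH, hG⟩ := exists_dot_eq_of_abs_le hH hg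
    exact ⟨G, hHc.of_abs_le (abs_le_iff.1 hGH), hG⟩

theorem R_abs (f : OrdDual A) : R |f| = R f := by
  ext g
  rw [mem_R_iff, mem_R_iff, abs_abs]

theorem isSolid_R (f : OrdDual A) : LatticeOrderedAddCommGroup.IsSolid (R f) := by
  intro h hh g hgh
  obtain ⟨H, hH, hHc, hle⟩ := mem_R_iff.1 hh
  exact mem_R_iff.2 ⟨H, hH, hHc, hgh.trans hle⟩

theorem coe_map_dotₗ_orderContinuousDual (f : OrdDual A) :
    ((orderContinuousDual (OrdDual A)).map (dotₗ f) : Set (OrdDual A)) = R f :=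
  rfl

end OrdDual

end FAlgebra

theorem corollary2p3_general {A : Type*} [NonUnitalRing A] [Module ℝ A] [Lattice A] [IsFAlgebra A]
    (f : OrdDual A) :
    OrdDual.R f = OrdDual.R |f| ∧ IsOrderIdeal (OrdDual.R f) :=
  ⟨(OrdDual.R_abs f).symm, ⟨_, OrdDual.coe_map_dotₗ_orderContinuousDual f⟩, OrdDual.isSolid_R f⟩

theorem corollary2p3 {A : Type*} [NonUnitalRing A] [Module ℝ A] [Lattice A] [IsFAlgebra A]
    (hA : HasSeparatingOrdDual A) (f : OrdDual A) :
    OrdDual.R f = OrdDual.R |f| ∧ IsOrderIdeal (OrdDual.R f) :=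
  corollary2p3_general f
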